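/- Let $A\in\mathbb R^{d\times d}$, $B\in\mathbb R^{d\times q}$, $K\in\mathbb R^{q\times d}$ be such that $A+BK$ is Hurwitz (all its eigenvalues have negative real part), and let $W:\mathbb R\to\mathbb R^{q\times p}$ be a (Lebesgue measurable) matrix function. Assume that (i) $W$ is uniformly bounded: there is $C>0$ with $\|W(t)\|<C$ for all $t\in\mathbb R$; (ii) $W^TW$ is persistently exciting: there are $\delta>0$, $c_1>0$ and $c_2>0$ such that for every $t_0\ge 0$ $$c_1 I \succ \int_{t_0}^{t_0+\delta} W(t)^TW(t)\,dt \succ c_2 I ,$$ where $X\succ Y$ means that $X-Y$ is positive definite. Let $\Phi(t_1,t_2)$, $t_1,t_2\in\mathbb R$, be the state transition matrix of the linear time-varying system of tracking and parameter errors $$\begin{bmatrix}\dot e\\ \dot\phi\end{bmatrix}=\begin{bmatrix}A+BK & BW(t)\\ 0& -W(t)^TW(t)\end{bmatrix}\begin{bmatrix}e\\ \phi\end{bmatrix},$$ that is, for each $t_2$ the function $t\mapsto\Phi(t,t_2)$ is the (Carathéodory) solution of $\frac{d}{dt}\Phi(t,t_2)=F(t)\Phi(t,t_2)$, $\Phi(t_2,t_2)=I$,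 where $F(t)$ is the block matrix above. Then there exist $M>0$ and $\zeta>0$ such that for all $t_1\ge t_2\ge 0$ $$\|\Phi(t_1,t_2)\|\le M e^{-\zeta(t_1-t_2)} .$$ That is, the idealized error dynamics are exponentially stable (uniformly in the initial time $t_2 \ge 0$). -/

import Mathlib

open MeasureTheory Set
open scoped Matrix Matrix.Norms.L2Operator

/-- A real square matrix is Hurwitz if all its complex eigenvalues have negative real part. -/
def IsHurwitz {ι : Type*} [Fintype ι] [DecidableEq ι] (M : Matrix ι ι ℝ) : Prop :=
  ∀ z ∈ spectrum ℂ (M.map (algebraMap ℝ ℂ)), z.re < 0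

/-- `W` is persistently exciting: there are `δ, c₁, c₂ > 0` such that, for every `t₀ ≥ 0`,
`c₁ I > ∫_{t₀}^{t₀ + δ} Wᵀ(t) W(t) dt > c₂ I` in the sense of positive definiteness. -/
def PersistentlyExciting {q p : ℕ} (W : ℝ → Matrix (Fin q) (Fin p) ℝ) : Prop :=
  ∃ δ > (0 : ℝ), ∃ c₁ > (0 : ℝ), ∃ c₂ > (0 : ℝ), ∀ t₀ ≥ (0 : ℝ),
    (c₁ • (1 : Matrix (Fin p) (Fin p) ℝ) - ∫ t in t₀..(t₀ + δ), (W t)ᵀ * W t).PosDef ∧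
    ((∫ t in t₀..(t₀ + δ), (W t)ᵀ * W t) - c₂ • (1 : Matrix (Fin p) (Fin p) ℝ)).PosDef

/-- The matrix `[[A + B K, B W(t)], [0, -Wᵀ(t) W(t)]]` of the joint dynamics of the tracking
error and of the parameter error. -/
def errorDynamics {d q p : ℕ} (A : Matrix (Fin d) (Fin d) ℝ) (B : Matrix (Fin d) (Fin q) ℝ)
    (K : Matrix (Fin q) (Fin d) ℝ) (W : ℝ → Matrix (Fin q) (Fin p) ℝ) (t : ℝ) :
    Matrix (Fin d ⊕ Fin p) (Fin d ⊕ Fin p) ℝ :=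
  Matrix.fromBlocks (A + B * K) (B * W t) 0 (-((W t)ᵀ * W t))

/-- `Φ` is the state transition matrix of `x' = F(t) x`: for each `s`, the function `Φ(·, s)` is
the (Carathéodory) solution on the whole line of `d/dt Φ(t, s) = F(t) Φ(t, s)`, `Φ(s, s) = I`.
That is, it is locally absolutely continuous and satisfies the equation for almost every `t`
(for every `t`, if `F` is continuous). Norms of matrices are Euclidean operator norms. -/
structure IsStateTransitionMatrix {ι : Type*} [Fintype ι] [DecidableEq ι]
    (F : ℝ → Matrix ι ι ℝ) (Φ : ℝ → ℝ → Matrix ι ι ℝ) : Prop where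
  absolutelyContinuous : ∀ s a b : ℝ, AbsolutelyContinuousOnInterval (fun t => Φ t s) a b
  hasDerivAt : ∀ s : ℝ, ∀ᵐ t, HasDerivAt (fun t => Φ t s) (F t * Φ t s) t
  self : ∀ s : ℝ, Φ s s = 1

theorem intervalIntegrable_picard {R : Type*} [NormedRing R] {F g : ℝ → R} {C : ℝ} (hF : AEStronglyMeasurable F volume)
    (hC : ∀ t, ‖F t‖ ≤ C) (hg : Continuous g) (a b : ℝ) :
    IntervalIntegrable (fun τ => F τ * g τ) volume a b := by
  have h1 : IntervalIntegrable F volume a b := by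
    rw [intervalIntegrable_iff]
    refine Measure.integrableOn_of_bounded (M := C) (by simp) hF ?_
    exact Filter.Eventually.of_forall hC
  exact h1.mul_continuousOn hg.continuousOn

section StateTransition

variable {R : Type*} [NormedRing R] [NormedAlgebra ℝ R]

/-- One step of the Picard iteration for a linear equation with bounded coefficient. -/
theorem norm_picard_step_le {F g : ℝ → R} {C N s : ℝ} (hC : ∀ t, ‖F t‖ ≤ C) (k : ℕ) {T : ℝ}
    (hg : ∀ t ∈ uIcc s T, ‖g t‖ ≤ N * ((C * |t - s|) ^ k / (k.factorial : ℝ)))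
    {t : ℝ} (ht : t ∈ uIcc s T) :
    ‖∫ τ in s..t, F τ * g τ‖ ≤
      N * ((C * |t - s|) ^ (k + 1) / ((k + 1).factorial : ℝ)) := by
  have hC0 : 0 ≤ C := (norm_nonneg _).trans (hC 0)
  have h1 : ‖∫ τ in s..t, F τ * g τ‖ ≤
      ∫ τ in uIoc s t, C * (N * (C ^ k / (k.factorial : ℝ))) * |τ - s| ^ k := by
    rw [intervalIntegral.norm_intervalIntegral_eq]
    refine norm_integral_le_of_norm_le ?_ ?_
    · have : Continuous fun τ : ℝ => C * (N * (C ^ k / (k.factorial : ℝ))) * |τ - s| ^ k := by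
        fun_prop
      exact (this.intervalIntegrable s t).def'
    · refine (ae_restrict_iff' measurableSet_uIoc).2 (Filter.Eventually.of_forall fun τ hτ => ?_)
      have hτ' : τ ∈ uIcc s T :=
        (uIcc_subset_uIcc left_mem_uIcc ht) (uIoc_subset_uIcc hτ)
      calc ‖F τ * g τ‖ ≤ ‖F τ‖ * ‖g τ‖ := norm_mul_le _ _
        _ ≤ C * (N * ((C * |τ - s|) ^ k / (k.factorial : ℝ))) := by
            gcongr
            · exact hC τ
            · exact hg τ hτ'
        _ = _ := by rw [mul_pow]; ring
  refine h1.trans (le_of_eq ?_)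
  rw [integral_const_mul, integral_pow_abs_sub_uIoc, Nat.factorial_succ]
  have : (k.factorial : ℝ) ≠ 0 := by positivity
  push_cast
  rw [mul_pow, pow_succ C]
  field_simp

/-- The successive terms of the Picard iteration. -/
noncomputable def picardTerm (F : ℝ → R) (s : ℝ) : ℕ → ℝ → R
  | 0 => fun _ => 1
  | k + 1 => fun t => ∫ τ in s..t, F τ * picardTerm F s k τ

theorem continuous_picardTerm {F : ℝ → R} {C : ℝ} (hF : AEStronglyMeasurable F volume)
    (hC : ∀ t, ‖F t‖ ≤ C) (s : ℝ) (k : ℕ) : Continuous (picardTerm F s k) := by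
  induction k with
  | zero => exact continuous_const
  | succ k ih =>
    exact intervalIntegral.continuous_primitive
      (fun a b => intervalIntegrable_picard hF hC ih a b) s

theorem norm_picardTerm_le {F : ℝ → R} {C : ℝ}
    (hC : ∀ t, ‖F t‖ ≤ C) (s : ℝ) (k : ℕ) (t : ℝ) :
    ‖picardTerm F s k t‖ ≤ ‖(1 : R)‖ * ((C * |t - s|) ^ k / (k.factorial : ℝ)) := by
  induction k generalizing t with
  | zero => simp [picardTerm]
  | succ k ih => exact norm_picard_step_le hC k (T := t) (fun τ _ => ih τ) right_mem_uIcc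

/-- A linear equation with bounded measurable coefficient has a solution in integral form. -/
theorem exists_linear_integral_solution [CompleteSpace R] {F : ℝ → R} {C : ℝ}
    (hF : AEStronglyMeasurable F volume) (hC : ∀ t, ‖F t‖ ≤ C) (s : ℝ) :
    ∃ g : ℝ → R, Continuous g ∧ ∀ t, g t = 1 + ∫ τ in s..t, F τ * g τ := by
  have hC0 : 0 ≤ C := (norm_nonneg _).trans (hC 0)
  have hsum (x : ℝ) : Summable fun k : ℕ => ‖(1 : R)‖ * (x ^ k / (k.factorial : ℝ)) :=
    (Real.summable_pow_div_factorial x).mul_left _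
  have hP (t : ℝ) : Summable fun k => picardTerm F s k t :=
    Summable.of_norm_bounded (hsum (C * |t - s|)) fun k => norm_picardTerm_le hC s k t
  have hcont : Continuous fun t => ∑' k, picardTerm F s k t := by
    rw [continuous_iff_continuousAt]
    intro t
    have h1 : ContinuousOn (fun t => ∑' k, picardTerm F s k t) (Metric.ball s (|t - s| + 1)) := by
      refine continuousOn_tsum (fun k => (continuous_picardTerm hF hC s k).continuousOn)
        (hsum (C * (|t - s| + 1))) fun k x hx => ?_
      refine (norm_picardTerm_le hC s k x).trans ?_
      have : |x - s| ≤ |t - s| + 1 := (Metric.mem_ball.1 hx).le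
      gcongr
    refine h1.continuousAt (Metric.isOpen_ball.mem_nhds ?_)
    rw [Metric.mem_ball, Real.dist_eq]
    linarith
  refine ⟨fun t => ∑' k, picardTerm F s k t, hcont, fun t => ?_⟩
  have h2 : HasSum (fun k => ∫ τ in s..t, F τ * picardTerm F s k τ)
      (∫ τ in s..t, F τ * ∑' k, picardTerm F s k τ) := by
    refine intervalIntegral.hasSum_integral_of_dominated_convergence
      (fun k _ => C * (‖(1 : R)‖ * ((C * |t - s|) ^ k / (k.factorial : ℝ)))) ?_ ?_ ?_ ?_ ?_
    · intro k
      exact (hF.mul (continuous_picardTerm hF hC s k).aestronglyMeasurable).restrict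
    · intro k
      refine Filter.Eventually.of_forall fun τ hτ => ?_
      have hτ' : |τ - s| ≤ |t - s| := abs_sub_left_of_mem_uIcc (uIoc_subset_uIcc hτ)
      calc _ ≤ ‖F τ‖ * ‖picardTerm F s k τ‖ := norm_mul_le _ _
        _ ≤ C * (‖(1 : R)‖ * ((C * |τ - s|) ^ k / (k.factorial : ℝ))) := by
            gcongr
            · exact hC τ
            · exact norm_picardTerm_le hC s k τ
        _ ≤ _ := by gcongr
    · exact Filter.Eventually.of_forall fun _ _ => (hsum _).mul_left _
    · exact intervalIntegrable_const
    · exact Filter.Eventually.of_forall fun τ _ => (hP τ).hasSum.mul_left _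
  change ∑' k, picardTerm F s k t = _
  rw [(hP t).tsum_eq_zero_add, ← h2.tsum_eq]
  rfl

theorem eq_zero_of_linear_integral {F g : ℝ → R} {C s : ℝ} (hC : ∀ t, ‖F t‖ ≤ C)
    (hg : Continuous g) (h : ∀ t, g t = ∫ τ in s..t, F τ * g τ) : g = 0 := by
  funext T
  obtain ⟨N, hN⟩ := isCompact_uIcc.exists_bound_of_continuousOn (hg.continuousOn (s := uIcc s T))
  have key (k : ℕ) : ∀ t ∈ uIcc s T, ‖g t‖ ≤ N * ((C * |t - s|) ^ k / (k.factorial : ℝ)) := by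
    induction k with
    | zero => intro t ht; simpa using hN t ht
    | succ k ih =>
      intro t ht
      rw [h t]
      exact norm_picard_step_le hC k ih ht
  have hlim := (FloorSemiring.tendsto_pow_div_factorial_atTop (C * |T - s|)).const_mul N
  rw [mul_zero] at hlim
  exact norm_le_zero_iff.1 (ge_of_tendsto' hlim fun k => key k T right_mem_uIcc)

end StateTransition

/-- The state transition matrix of a bounded measurable coefficient exists and is unique. -/
theorem existsUnique_isStateTransitionMatrix {ι : Type*} [Fintype ι] [DecidableEq ι]
    {F : ℝ → Matrix ι ι ℝ} {C : ℝ} (hF : AEStronglyMeasurable F volume)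
    (hC : ∀ t, ‖F t‖ ≤ C) : ∃! Φ, IsStateTransitionMatrix F Φ := by
  have hint {g : ℝ → Matrix ι ι ℝ} (hg : Continuous g) (a b : ℝ) :
      IntervalIntegrable (fun τ => F τ * g τ) volume a b :=
    intervalIntegrable_picard hF hC hg a b
  have hder {g : ℝ → Matrix ι ι ℝ} (hg : Continuous g) (s : ℝ) :
      ∀ᵐ t, HasDerivAt (fun t => ∫ τ in s..t, F τ * g τ) (F t * g t) t := by
    have hF' : LocallyIntegrable (fun τ => F τ * g τ) volume := by
      intro x
      refine ⟨Icc (x - 1) (x + 1), Icc_mem_nhds (by linarith) (by linarith), ?_⟩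
      have := hint hg (x - 1) (x + 1)
      rwa [intervalIntegrable_iff_integrableOn_Icc_of_le (by linarith)] at this
    filter_upwards [_root_.LocallyIntegrable.ae_hasDerivAt_integral hF'] with t ht using ht s
  have hac {g : ℝ → Matrix ι ι ℝ} (hg : Continuous g) (s a b : ℝ) :
      AbsolutelyContinuousOnInterval (fun t => ∫ τ in s..t, F τ * g τ) a b := by
    have hC0 : 0 ≤ C := (norm_nonneg _).trans (hC 0)
    obtain ⟨N, hN⟩ := isCompact_uIcc.exists_bound_of_continuousOn (hg.continuousOn (s := uIcc a b))
    have hN0 : 0 ≤ N := (norm_nonneg _).trans (hN a left_mem_uIcc)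
    refine LipschitzOnWith.absolutelyContinuousOnInterval (K := ⟨C * N, by positivity⟩) ?_
    refine LipschitzOnWith.of_dist_le_mul fun x hx y hy => ?_
    rw [dist_eq_norm, intervalIntegral.integral_interval_sub_left (hint hg _ _) (hint hg _ _),
      Real.dist_eq]
    refine intervalIntegral.norm_integral_le_of_norm_le_const fun τ hτ => ?_
    have hτ' : τ ∈ uIcc a b := uIcc_subset_uIcc hy hx (uIoc_subset_uIcc hτ)
    calc _ ≤ ‖F τ‖ * ‖g τ‖ := norm_mul_le _ _
      _ ≤ C * N := by
        gcongr
        · exact hC τ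
        · exact hN τ hτ'
  have hconst (a b : ℝ) :
      AbsolutelyContinuousOnInterval (fun _ : ℝ => (1 : Matrix ι ι ℝ)) a b :=
    LipschitzOnWith.absolutelyContinuousOnInterval (K := 0)
      (LipschitzWith.const _).lipschitzOnWith
  choose G hGc hG using fun s => exists_linear_integral_solution hF hC s
  have hG' (s : ℝ) : G s = fun t => 1 + ∫ τ in s..t, F τ * G s τ := funext (hG s)
  refine ⟨fun t s => G s t, ⟨fun s a b => ?_, fun s => ?_, fun s => ?_⟩, fun Ψ hΨ => ?_⟩
  · have := (hconst a b).add (hac (hGc s) s a b)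
    change AbsolutelyContinuousOnInterval (G s) a b
    rw [hG' s]
    exact this
  · filter_upwards [hder (hGc s) s] with t ht
    have h1 := ht.const_add (1 : Matrix ι ι ℝ)
    rw [← hG' s] at h1
    exact h1
  · simp [hG s s]
  · funext t s
    have hcont : Continuous fun t => Ψ t s := by
      rw [continuous_iff_continuousAt]
      intro x
      refine (hΨ.absolutelyContinuous s (x - 1) (x + 1)).continuousOn.continuousAt ?_
      rw [uIcc_of_le (by linarith)]
      exact Icc_mem_nhds (by linarith) (by linarith)
    have hΨint (t : ℝ) : Ψ t s = 1 + ∫ τ in s..t, F τ * Ψ τ s := by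
      have h1 := (hΨ.absolutelyContinuous s s t).sub (hac hcont s s t)
      obtain ⟨c, hc⟩ := h1.const_of_ae_hasDerivAt_zero (by
        filter_upwards [hΨ.hasDerivAt s, hder hcont s] with τ h2 h3 _
        simpa using h2.sub h3)
      have hs := hc s left_mem_uIcc
      have ht := hc t right_mem_uIcc
      simp only [Pi.sub_apply, hΨ.self, intervalIntegral.integral_same, sub_zero] at hs ht
      rw [hs, ← ht]
      abel
    have h0 := eq_zero_of_linear_integral (F := F) (s := s) (g := fun t => Ψ t s - G s t) hC
      (hcont.sub (hGc s)) (fun t => by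
        simp only [mul_sub]
        rw [intervalIntegral.integral_sub (hint hcont _ _) (hint (hGc s) _ _), hΨint t, hG s t]
        abel)
    exact sub_eq_zero.1 (congrFun h0 t)

/-- For bounded measurable `W` the error dynamics have exactly one state transition matrix. -/
theorem existsUnique_errorDynamics {d q p : ℕ}
    (A : Matrix (Fin d) (Fin d) ℝ) (B : Matrix (Fin d) (Fin q) ℝ) (K : Matrix (Fin q) (Fin d) ℝ)
    (W : ℝ → Matrix (Fin q) (Fin p) ℝ) (hW : AEStronglyMeasurable W volume)
    (hbdd : ∃ C > (0 : ℝ), ∀ t : ℝ, ‖W t‖ < C) :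
    ∃! Φ, IsStateTransitionMatrix (errorDynamics A B K W) Φ := by
  obtain ⟨C, -, h⟩ := hbdd
  have hc : Continuous fun w : Matrix (Fin q) (Fin p) ℝ =>
      Matrix.fromBlocks (A + B * K) (B * w) 0 (-(wᵀ * w)) := by
    fun_prop
  obtain ⟨D, hD⟩ := (isCompact_closedBall (0 : Matrix (Fin q) (Fin p) ℝ) C
    ).exists_bound_of_continuousOn hc.continuousOn
  exact existsUnique_isStateTransitionMatrix (C := D) (hc.comp_aestronglyMeasurable hW)
    fun t => hD _ (by simpa using (h t).le)

/-! ### Calculus for locally Lipschitz curves -/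

section LocallyLipschitz

/-! The system is a cascade: `φ` evolves on its own and drives `e` through the bounded input `B W
φ`.

For `φ' = -WᵀWφ`, the energy `‖φ‖²` drops over one excitation window by `2J`, where `J = ∫ ‖Wφ‖²`.
The displacement of `φ` in the window is also controlled by `J`, by Cauchy–Schwarz. So if `J` were
small, `φ` would be nearly frozen, and excitation of the frozen vector would force `J` to be large.
Hence each window contracts the energy by a fixed factor (`norm_sq_add_le_of_excitation`), and
iteration gives uniform exponential decay.

For `e`, the spectrum of `exp M` lies in the exponential of the spectrum of `M`, so Hurwitz gives
`exp M` spectral radius below one and the semigroup decays (`IsHurwitz.exists_norm_exp_le`).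
Variation of constants then bounds `e` by a decaying exponential times an affine function of elapsed
time (`norm_le_of_forcing`); half of the rate absorbs that factor.

Solutions are differentiable only almost everywhere. Bounded coefficients make them locally
Lipschitz, a property preserved by composition with `C¹` maps and sufficient for the fundamental
theorem of calculus. -/

theorem LocallyLipschitz.absolutelyContinuousOnInterval {X : Type*} [PseudoMetricSpace X]
    {f : ℝ → X} (hf : LocallyLipschitz f)
    (a b : ℝ) : AbsolutelyContinuousOnInterval f a b := by
  obtain ⟨K, hK⟩ := (hf.locallyLipschitzOn (s := uIcc a b)).exists_lipschitzOnWith_of_compact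
    isCompact_uIcc
  exact hK.absolutelyContinuousOnInterval

variable {E : Type*} [NormedAddCommGroup E] [NormedSpace ℝ E]

theorem locallyLipschitz_integral {g : ℝ → E}
    (hi : ∀ a b : ℝ, IntervalIntegrable g volume a b)
    (hb : ∀ a b : ℝ, ∃ N : ℝ, ∀ᵐ t, t ∈ uIcc a b → ‖g t‖ ≤ N) (s : ℝ) :
    LocallyLipschitz fun t => ∫ τ in s..t, g τ := by
  intro x
  obtain ⟨N, hN⟩ := hb (x - 1) (x + 1)
  refine ⟨⟨max N 0, le_max_right _ _⟩, Icc (x - 1) (x + 1),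
    Icc_mem_nhds (by linarith) (by linarith), ?_⟩
  rw [← uIcc_of_le (by linarith)]
  refine LipschitzOnWith.of_dist_le_mul fun y hy z hz => ?_
  rw [dist_eq_norm, intervalIntegral.integral_interval_sub_left (hi _ _) (hi _ _), Real.dist_eq]
  refine intervalIntegral.norm_integral_le_of_norm_le_const_ae ?_
  filter_upwards [hN] with τ hτ h
  exact (hτ (uIcc_subset_uIcc hz hy (uIoc_subset_uIcc h))).trans (le_max_left _ _)

theorem LocallyLipschitz.exists_ae_norm_deriv_le {f g : ℝ → E} (hf : LocallyLipschitz f)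
    (hd : ∀ᵐ t, HasDerivAt f (g t) t) (a b : ℝ) :
    ∃ N : ℝ, ∀ᵐ t, t ∈ uIcc a b → ‖g t‖ ≤ N := by
  -- The interval is enlarged by one on each side so that it is a neighbourhood of every point of
  -- `uIcc a b`, endpoints included.
  obtain ⟨K, hK⟩ := (hf.locallyLipschitzOn
    (s := Icc (min a b - 1) (max a b + 1))).exists_lipschitzOnWith_of_compact isCompact_Icc
  refine ⟨K, ?_⟩
  filter_upwards [hd] with t ht h
  exact ht.le_of_lipschitzOn (Icc_mem_nhds (by linarith [h.1]) (by linarith [h.2])) hK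

variable [CompleteSpace E]

/-- A derivative that exists almost everywhere and is locally bounded is interval integrable. -/
theorem intervalIntegrable_of_ae_hasDerivAt {f g : ℝ → E}
    (hd : ∀ᵐ t, HasDerivAt f (g t) t)
    (hb : ∀ a b : ℝ, ∃ N : ℝ, ∀ᵐ t, t ∈ uIcc a b → ‖g t‖ ≤ N) (a b : ℝ) :
    IntervalIntegrable g volume a b := by
  have hg : AEStronglyMeasurable g volume :=
    (aestronglyMeasurable_deriv f volume).congr (hd.mono fun t ht => ht.deriv)
  obtain ⟨N, hN⟩ := hb a b
  rw [intervalIntegrable_iff]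
  refine Measure.integrableOn_of_bounded (M := N) (by simp) hg ?_
  rw [ae_restrict_iff' measurableSet_uIoc]
  filter_upwards [hN] with t ht h using ht (uIoc_subset_uIcc h)

/-- Subtracting the primitive of `g` leaves an absolutely continuous function with derivative zero
almost everywhere, hence a constant. -/
theorem sub_eq_integral_of_absolutelyContinuous {f g : ℝ → E}
    (hf : ∀ a b : ℝ, AbsolutelyContinuousOnInterval f a b)
    (hd : ∀ᵐ t, HasDerivAt f (g t) t)
    (hb : ∀ a b : ℝ, ∃ N : ℝ, ∀ᵐ t, t ∈ uIcc a b → ‖g t‖ ≤ N) (a b : ℝ) :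
    f b - f a = ∫ t in a..b, g t := by
  have hi := intervalIntegrable_of_ae_hasDerivAt hd hb
  have hloc : LocallyIntegrable g volume := by
    intro x
    refine ⟨Icc (x - 1) (x + 1), Icc_mem_nhds (by linarith) (by linarith), ?_⟩
    have := hi (x - 1) (x + 1)
    rwa [intervalIntegrable_iff_integrableOn_Icc_of_le (by linarith)] at this
  obtain ⟨c, hc⟩ := ((hf a b).sub
    ((locallyLipschitz_integral hi hb a).absolutelyContinuousOnInterval a b)
    ).const_of_ae_hasDerivAt_zero (by
      filter_upwards [hd, _root_.LocallyIntegrable.ae_hasDerivAt_integral hloc] with t h1 h2 _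
      simpa using h1.sub (h2 a))
  have h1 := hc a left_mem_uIcc
  have h2 := hc b right_mem_uIcc
  simp only [Pi.sub_apply, intervalIntegral.integral_same, sub_zero] at h1 h2
  rw [h1, ← h2]
  abel

theorem locallyLipschitz_of_absolutelyContinuous {f g : ℝ → E}
    (hf : ∀ a b : ℝ, AbsolutelyContinuousOnInterval f a b)
    (hd : ∀ᵐ t, HasDerivAt f (g t) t)
    (hb : ∀ a b : ℝ, ∃ N : ℝ, ∀ᵐ t, t ∈ uIcc a b → ‖g t‖ ≤ N) : LocallyLipschitz f := by
  have hi := intervalIntegrable_of_ae_hasDerivAt hd hb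
  have h : f = fun t => f 0 + ∫ τ in (0 : ℝ)..t, g τ := by
    funext t
    rw [← sub_eq_integral_of_absolutelyContinuous hf hd hb 0 t]
    abel
  rw [h]
  exact (LocallyLipschitz.const _).add (locallyLipschitz_integral hi hb 0)

/-- The fundamental theorem of calculus for locally Lipschitz functions. -/
theorem LocallyLipschitz.sub_eq_integral {f g : ℝ → E} (hf : LocallyLipschitz f)
    (hd : ∀ᵐ t, HasDerivAt f (g t) t) (a b : ℝ) : f b - f a = ∫ t in a..b, g t :=
  sub_eq_integral_of_absolutelyContinuous hf.absolutelyContinuousOnInterval hd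
    (hf.exists_ae_norm_deriv_le hd) a b

end LocallyLipschitz

/-- Geometric decay along steps of length `δ` and control within a step give exponential decay. -/
theorem le_exp_of_step_le {f : ℝ → ℝ} {s δ r D : ℝ} (hδ : 0 < δ) (hr : 0 < r) (hr1 : r < 1)
    (hD : ∀ u ≥ s, ∀ t ∈ Icc u (u + δ), f t ≤ D * f u) (hD0 : 0 ≤ D)
    (hstep : ∀ t ≥ s, f (t + δ) ≤ r * f t) (hs : 0 ≤ f s) {t : ℝ} (ht : s ≤ t) :
    f t ≤ D / r * Real.exp (-(-Real.log r / δ) * (t - s)) * f s := by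
  have hpow (n : ℕ) : f (s + n * δ) ≤ r ^ n * f s := by
    induction n with
    | zero => simp
    | succ n ih =>
      have h1 := hstep (s + n * δ) (by have : (0 : ℝ) ≤ n * δ := by positivity
                                       linarith)
      calc f (s + (n + 1 : ℕ) * δ) = f (s + n * δ + δ) := by push_cast; ring_nf
        _ ≤ r * (r ^ n * f s) := h1.trans (by gcongr)
        _ = _ := by ring
  set n := ⌊(t - s) / δ⌋₊ with hn
  have h0 : 0 ≤ (t - s) / δ := div_nonneg (by linarith) hδ.le
  have h1 : (n : ℝ) * δ ≤ t - s := (le_div_iff₀ hδ).1 (Nat.floor_le h0)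
  have h2 : t - s ≤ (n + 1) * δ := ((div_lt_iff₀ hδ).1 (Nat.lt_floor_add_one _)).le
  -- Rounding the number of steps down loses at most one factor `r`, since `n + 1 ≥ (t - s) / δ`;
  -- this is the origin of `1 / r`.
  have h3 : r ^ n ≤ 1 / r * Real.exp (-(-Real.log r / δ) * (t - s)) := by
    have h4 : r ^ (n + 1) ≤ Real.exp (-(-Real.log r / δ) * (t - s)) := by
      rw [← Real.rpow_natCast, Real.rpow_def_of_pos hr]
      refine Real.exp_le_exp.2 ?_
      have hl : Real.log r < 0 := Real.log_neg hr hr1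
      have h5 : (t - s) / δ ≤ n + 1 := (div_le_iff₀ hδ).2 h2
      have h6 : -(-Real.log r / δ) * (t - s) = Real.log r * ((t - s) / δ) := by ring
      rw [h6]
      push_cast
      exact mul_le_mul_of_nonpos_left h5 hl.le
    rw [one_div_mul_eq_div, le_div_iff₀ hr, ← pow_succ]
    exact h4
  have h7 := hD (s + n * δ) (by have : (0 : ℝ) ≤ n * δ := by positivity
                                linarith) t ⟨by linarith, by linarith⟩
  calc f t ≤ D * (r ^ n * f s) := h7.trans (by gcongr; exact hpow n)
    _ ≤ D * ((1 / r * Real.exp (-(-Real.log r / δ) * (t - s))) * f s) := by gcongr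
    _ = _ := by ring

/-! ### Decay of the exponential of a Hurwitz matrix -/

section Exponential

open Filter Topology NormedSpace

variable {n : Type*} [Fintype n] [DecidableEq n]

theorem Matrix.exp_mulVec_of_mulVec_eq_smul {M : Matrix n n ℂ} {z : ℂ} {w : n → ℂ}
    (hw : M *ᵥ w = z • w) : exp M *ᵥ w = Complex.exp z • w := by
  have hpow (k : ℕ) : M ^ k *ᵥ w = z ^ k • w := by
    induction k with
    | zero => simp
    | succ k ih => rw [pow_succ, ← Matrix.mulVec_mulVec, hw, Matrix.mulVec_smul, ih, smul_smul,
        ← pow_succ']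
  have hc : Continuous fun A : Matrix n n ℂ => A *ᵥ w := by fun_prop
  have h1 := (exp_series_hasSum_exp' (𝕂 := ℂ) M).map
    ((Matrix.mulVecBilin ℂ ℂ).flip w : Matrix n n ℂ →ₗ[ℂ] (n → ℂ)) hc
  have h2 := (exp_series_hasSum_exp' (𝕂 := ℂ) z).smul_const w
  refine h1.unique ?_
  rw [Complex.exp_eq_exp_ℂ]
  convert h2 using 2 with k
  simp [hpow, smul_smul]

/-- `M` commutes with `exp M`, so it preserves the `l`-eigenspace of `exp M` and, over `ℂ`, has an
eigenvector there. On that vector `exp M` acts both as `l` and as `exp z`. -/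
theorem Matrix.exists_mem_spectrum_of_mem_spectrum_exp {M : Matrix n n ℂ} {l : ℂ}
    (hl : l ∈ spectrum ℂ (exp M)) : ∃ z ∈ spectrum ℂ M, l = Complex.exp z := by
  rw [← Matrix.spectrum_toLin', ← Module.End.hasEigenvalue_iff_mem_spectrum] at hl
  have hcomm : Commute (Matrix.toLin' (exp M)) (Matrix.toLin' M) := by
    have h : Commute (exp M) M := (Commute.refl M).exp_left
    rw [commute_iff_eq, Module.End.mul_eq_comp, Module.End.mul_eq_comp,
      ← Matrix.toLin'_mul, ← Matrix.toLin'_mul, h.eq]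
  have hmaps := Module.End.mapsTo_genEigenspace_of_comm hcomm l 1
  have : Nontrivial (Module.End.genEigenspace (Matrix.toLin' (exp M)) l 1) :=
    Submodule.nontrivial_iff_ne_bot.2 hl
  obtain ⟨z, hz⟩ := Module.End.exists_eigenvalue ((Matrix.toLin' M).restrict hmaps)
  obtain ⟨⟨w, hw⟩, hzw⟩ := hz.exists_hasEigenvector
  have hw0 : w ≠ 0 := fun h => hzw.2 (Subtype.ext h)
  have hMw : M *ᵥ w = z • w := congrArg Subtype.val hzw.apply_eq_smul
  refine ⟨z, ?_, ?_⟩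
  · rw [← Matrix.spectrum_toLin', ← Module.End.hasEigenvalue_iff_mem_spectrum]
    exact Module.End.hasEigenvalue_of_hasEigenvector (x := w)
      ⟨Module.End.mem_eigenspace_iff.2 (by simpa using hMw), hw0⟩
  · have h1 : exp M *ᵥ w = l • w := by
      have := Module.End.mem_eigenspace_iff.1 hw
      simpa using this
    rw [Matrix.exp_mulVec_of_mulVec_eq_smul hMw] at h1
    exact (smul_left_injective ℂ hw0 h1).symm

/-- By Gelfand's formula `‖a ^ k‖` is eventually at most `r ^ k` for any `r` strictly between the
spectral radius and one. -/
theorem tendsto_pow_of_spectralRadius_lt_one {A : Type*} [NormedRing A] [NormedAlgebra ℂ A]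
    [CompleteSpace A] {a : A} (ha : spectralRadius ℂ a < 1) :
    Tendsto (fun k : ℕ => a ^ k) atTop (𝓝 0) := by
  obtain ⟨r, hr, hr1⟩ := ENNReal.lt_iff_exists_nnreal_btwn.1 ha
  have hr1' : r < 1 := by exact_mod_cast hr1
  have h := (spectrum.pow_nnnorm_pow_one_div_tendsto_nhds_spectralRadius a).eventually_lt_const hr
  have h2 : ∀ᶠ k : ℕ in atTop, ‖a ^ k‖ ≤ (r : ℝ) ^ k := by
    filter_upwards [h, eventually_gt_atTop 0] with k hk hk0
    have hk1 : (k : ℝ) ≠ 0 := by positivity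
    have h3 := ENNReal.rpow_le_rpow hk.le (z := (k : ℝ)) (by positivity)
    rw [← ENNReal.rpow_mul, one_div, inv_mul_cancel₀ hk1, ENNReal.rpow_one,
      ENNReal.rpow_natCast] at h3
    exact_mod_cast h3
  exact squeeze_zero_norm' h2 (tendsto_pow_atTop_nhds_zero_of_lt_one r.2 (by exact_mod_cast hr1'))

theorem Matrix.exp_map_ofReal (M : Matrix n n ℝ) :
    exp (M.map (algebraMap ℝ ℂ)) = (exp M).map (algebraMap ℝ ℂ) := by
  have hc : Continuous (RingHom.mapMatrix (m := n) (algebraMap ℝ ℂ)) := by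
    change Continuous fun M : Matrix n n ℝ => M.map (algebraMap ℝ ℂ)
    exact continuous_id.matrix_map (continuous_algebraMap ℝ ℂ)
  have h1 := (exp_series_hasSum_exp' (𝕂 := ℝ) M).map (RingHom.mapMatrix (algebraMap ℝ ℂ)) hc
  have h2 := exp_series_hasSum_exp' (𝕂 := ℂ) (M.map (algebraMap ℝ ℂ))
  have hterm (k : ℕ) : ((k.factorial : ℂ)⁻¹ • M.map (algebraMap ℝ ℂ) ^ k) =
      RingHom.mapMatrix (algebraMap ℝ ℂ) ((k.factorial : ℝ)⁻¹ • M ^ k) := by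
    rw [← RingHom.mapMatrix_apply, ← map_pow]
    ext i j
    simp
  simp only [hterm] at h2
  exact h2.unique h1

theorem IsHurwitz.tendsto_exp_pow {M : Matrix n n ℝ} (hM : IsHurwitz M) :
    Tendsto (fun k : ℕ => exp M ^ k) atTop (𝓝 0) := by
  have h1 : spectralRadius ℂ (exp (M.map (algebraMap ℝ ℂ))) < 1 := by
    rcases (spectrum ℂ (exp (M.map (algebraMap ℝ ℂ)))).eq_empty_or_nonempty with h | h
    -- This case covers an empty index type, where the spectrum is empty.
    · rw [spectralRadius, h]
      simp
    · refine spectrum.spectralRadius_lt_of_forall_lt_of_nonempty h (r := 1) fun l hl => ?_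
      obtain ⟨z, hz, rfl⟩ := Matrix.exists_mem_spectrum_of_mem_spectrum_exp hl
      rw [← NNReal.coe_lt_coe, coe_nnnorm, Complex.norm_exp]
      simpa using hM z hz
  have h2 := tendsto_pow_of_spectralRadius_lt_one h1
  -- Entrywise real parts bring the complex limit back to powers of the real matrix.
  have hc : Continuous fun A : Matrix n n ℂ => A.map Complex.re :=
    continuous_id.matrix_map Complex.continuous_re
  have h3 := (hc.tendsto 0).comp h2
  convert h3 using 2 with k
  · rw [Function.comp_apply, Matrix.exp_map_ofReal, ← RingHom.mapMatrix_apply, ← map_pow]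
    ext i j
    simp
  · ext i j
    simp

/-- The matrix exponential of a Hurwitz matrix decays exponentially. -/
theorem IsHurwitz.exists_norm_exp_le {M : Matrix n n ℝ} (hM : IsHurwitz M) :
    ∃ C > (0 : ℝ), ∃ α > (0 : ℝ), ∀ t ≥ (0 : ℝ), ‖exp (t • M)‖ ≤ C * Real.exp (-α * t) := by
  -- A positive `k` with `‖exp M ^ k‖ < 1 / 2` serves as the step length in `le_exp_of_step_le`,
  -- with ratio `1 / 2`.
  have h := (hM.tendsto_exp_pow.norm.eventually_lt_const
    (show ‖(0 : Matrix n n ℝ)‖ < 1 / 2 by simp)).and (eventually_gt_atTop 0)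
  obtain ⟨k, hk, hk0⟩ := h.exists
  have hk0' : (0 : ℝ) < k := by exact_mod_cast hk0
  have hadd (u v : ℝ) : exp ((u + v) • M) = exp (u • M) * exp (v • M) := by
    rw [add_smul, Matrix.exp_add_of_commute]
    exact ((Commute.refl M).smul_left u).smul_right v
  have hcont : Continuous fun t : ℝ => exp (t • M) := by
    rw [continuous_iff_continuousAt]
    exact fun t => (hasDerivAt_exp_smul_const' M t).continuousAt
  obtain ⟨D, hD⟩ := (isCompact_Icc (a := (0 : ℝ)) (b := k)).exists_bound_of_continuousOn
    hcont.continuousOn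
  have hD0 : 0 ≤ D := (norm_nonneg _).trans (hD 0 ⟨le_rfl, hk0'.le⟩)
  have hkM : exp ((k : ℝ) • M) = exp M ^ k := by
    rw [Nat.cast_smul_eq_nsmul, Matrix.exp_nsmul]
  refine ⟨D / (1 / 2) * ‖exp ((0 : ℝ) • M)‖ + 1, by positivity, -Real.log (1 / 2) / k, ?_,
    fun t ht => ?_⟩
  · exact div_pos (neg_pos.2 (Real.log_neg (by norm_num) (by norm_num))) hk0'
  have := le_exp_of_step_le (f := fun t => ‖exp (t • M)‖) (s := 0) (δ := k) (r := 1 / 2) (D := D)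
    hk0' (by norm_num) (by norm_num) (fun u _ t ht => by
      have h1 : t = (t - u) + u := by ring
      have h2 := hD (t - u) ⟨by linarith [ht.1], by linarith [ht.2]⟩
      rw [h1, hadd]
      exact (norm_mul_le _ _).trans (by gcongr)) hD0 (fun t _ => by
      rw [add_comm, hadd, hkM]
      exact (norm_mul_le _ _).trans (by gcongr)) (norm_nonneg _) ht
  rw [sub_zero] at this
  refine this.trans ?_
  have h3 := (Real.exp_pos (-(-Real.log (1 / 2) / k) * t)).le
  nlinarith

end Exponential

/-! ### Decay of the parameter error under persistent excitation -/

section Excitation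

open scoped RealInnerProductSpace

/-- Cauchy–Schwarz against the constant `1`, obtained by integrating `(δ h - I)² / δ ≥ 0`. -/
theorem sq_intervalIntegral_le {h : ℝ → ℝ} {a δ : ℝ} (hδ : 0 < δ)
    (h1 : IntervalIntegrable h volume a (a + δ))
    (h2 : IntervalIntegrable (fun t => h t ^ 2) volume a (a + δ)) :
    (∫ t in a..(a + δ), h t) ^ 2 ≤ δ * ∫ t in a..(a + δ), h t ^ 2 := by
  set I := ∫ t in a..(a + δ), h t with hI
  have h3 : ∫ t in a..(a + δ), (δ * h t ^ 2 + I ^ 2 / δ - 2 * I * h t) =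
      δ * (∫ t in a..(a + δ), h t ^ 2) + I ^ 2 - 2 * I * I := by
    rw [intervalIntegral.integral_sub ((h2.const_mul δ).add intervalIntegrable_const)
      (h1.const_mul _), intervalIntegral.integral_add (h2.const_mul δ) intervalIntegrable_const]
    simp only [intervalIntegral.integral_const_mul, intervalIntegral.integral_const, ← hI]
    simp only [add_sub_cancel_left, smul_eq_mul]
    field_simp
  have h4 : 0 ≤ ∫ t in a..(a + δ), (δ * h t ^ 2 + I ^ 2 / δ - 2 * I * h t) := by
    refine intervalIntegral.integral_nonneg (by linarith) fun t _ => ?_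
    have : δ * h t ^ 2 + I ^ 2 / δ - 2 * I * h t = (δ * h t - I) ^ 2 / δ := by
      field_simp
      ring
    rw [this]
    positivity
  nlinarith

variable {E F : Type*} [NormedAddCommGroup E] [InnerProductSpace ℝ E]
  [NormedAddCommGroup F] [NormedSpace ℝ F]

theorem intervalIntegrable_norm_apply_pow {W : ℝ → E →L[ℝ] F} {C : ℝ}
    (hW : AEStronglyMeasurable W volume) (hC : ∀ t, ‖W t‖ ≤ C) {v : ℝ → E} (hv : Continuous v)
    (k : ℕ) (a b : ℝ) : IntervalIntegrable (fun t => ‖W t (v t)‖ ^ k) volume a b := by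
  have hC0 : 0 ≤ C := (norm_nonneg _).trans (hC 0)
  obtain ⟨N, hN⟩ := isCompact_uIcc.exists_bound_of_continuousOn (hv.continuousOn (s := uIcc a b))
  have hm : AEStronglyMeasurable (fun t => W t (v t)) volume :=
    isBoundedBilinearMap_apply.continuous.comp_aestronglyMeasurable
      (hW.prodMk hv.aestronglyMeasurable)
  rw [intervalIntegrable_iff]
  refine Measure.integrableOn_of_bounded (M := (C * N) ^ k) (by simp) (hm.norm.pow k) ?_
  rw [ae_restrict_iff' measurableSet_uIoc]
  refine Filter.Eventually.of_forall fun t ht => ?_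
  rw [norm_pow, norm_norm]
  gcongr
  exact ((W t).le_opNorm _).trans
    (mul_le_mul (hC t) (hN t (uIoc_subset_uIcc ht)) (norm_nonneg _) hC0)

theorem norm_sq_sub_norm_sq_eq_integral {φ g : ℝ → E} (hφ : LocallyLipschitz φ)
    (hd : ∀ᵐ t, HasDerivAt φ (g t) t) (a b : ℝ) :
    ‖φ b‖ ^ 2 - ‖φ a‖ ^ 2 = ∫ t in a..b, 2 * ⟪φ t, g t⟫ := by
  have h1 : LocallyLipschitz fun t => ‖φ t‖ ^ 2 :=
    ((contDiff_norm_sq ℝ (E := E) (n := 1)).locallyLipschitz).comp hφ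
  exact h1.sub_eq_integral (hd.mono fun t ht => ht.norm_sq) a b

theorem norm_sq_antitone_of_dissipative {φ G : ℝ → E} (hφ : LocallyLipschitz φ)
    (hd : ∀ᵐ t, HasDerivAt φ (-G t) t) (hG : ∀ t, 0 ≤ ⟪φ t, G t⟫) :
    Antitone fun t => ‖φ t‖ ^ 2 := by
  intro a b hab
  have h1 := norm_sq_sub_norm_sq_eq_integral hφ hd a b
  have h2 : 0 ≤ ∫ t in a..b, 2 * ⟪φ t, G t⟫ :=
    intervalIntegral.integral_nonneg hab fun t _ => by linarith [hG t]
  simp only [inner_neg_right, mul_neg, intervalIntegral.integral_neg] at h1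
  change ‖φ b‖ ^ 2 ≤ ‖φ a‖ ^ 2
  linarith

variable [CompleteSpace E]

/-- One period of persistent excitation contracts the solutions of `φ' = -G`, where `G` stands for
`W†Wφ`. -/
theorem norm_sq_add_le_of_excitation {W : ℝ → E →L[ℝ] F} {C δ c : ℝ}
    (hW : AEStronglyMeasurable W volume) (hC : ∀ t, ‖W t‖ ≤ C) (hδ : 0 < δ) {φ G : ℝ → E}
    (hφ : LocallyLipschitz φ) (hd : ∀ᵐ t, HasDerivAt φ (-G t) t)
    (hG : ∀ t, ⟪φ t, G t⟫ = ‖W t (φ t)‖ ^ 2) (hGC : ∀ t, ‖G t‖ ≤ C * ‖W t (φ t)‖) {t₀ : ℝ}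
    (hpe : c * ‖φ t₀‖ ^ 2 ≤ ∫ t in t₀..(t₀ + δ), ‖W t (φ t₀)‖ ^ 2) :
    ‖φ (t₀ + δ)‖ ^ 2 ≤ (1 - c / (1 + C ^ 4 * δ ^ 2)) * ‖φ t₀‖ ^ 2 := by
  have hC0 : 0 ≤ C := (norm_nonneg _).trans (hC 0)
  have hi := fun k => intervalIntegrable_norm_apply_pow hW hC hφ.continuous k t₀ (t₀ + δ)
  have hi1 : IntervalIntegrable (fun t => ‖W t (φ t)‖) volume t₀ (t₀ + δ) := by simpa using hi 1
  set J := ∫ t in t₀..(t₀ + δ), ‖W t (φ t)‖ ^ 2 with hJ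
  have hV : ‖φ (t₀ + δ)‖ ^ 2 - ‖φ t₀‖ ^ 2 = -2 * J := by
    rw [norm_sq_sub_norm_sq_eq_integral hφ hd, hJ, ← intervalIntegral.integral_const_mul]
    simp [inner_neg_right, hG]
  -- The displacement is at most `C ∫ ‖Wφ‖`, and Cauchy–Schwarz bounds this by the dissipation `J`.
  have hdist (t : ℝ) (ht : t ∈ Icc t₀ (t₀ + δ)) : ‖φ t - φ t₀‖ ^ 2 ≤ C ^ 2 * (δ * J) := by
    have h1 : ‖φ t - φ t₀‖ ≤ C * ∫ τ in t₀..(t₀ + δ), ‖W τ (φ τ)‖ := by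
      rw [hφ.sub_eq_integral hd]
      calc ‖∫ τ in t₀..t, -G τ‖ ≤ ∫ τ in t₀..t, C * ‖W τ (φ τ)‖ :=
            intervalIntegral.norm_integral_le_of_norm_le ht.1
              (Filter.Eventually.of_forall fun τ _ => by rw [norm_neg]; exact hGC τ)
              ((hi1.const_mul C).mono_set (uIcc_subset_uIcc_left (Icc_subset_uIcc ht)))
        _ ≤ ∫ τ in t₀..(t₀ + δ), C * ‖W τ (φ τ)‖ :=
            intervalIntegral.integral_mono_interval le_rfl ht.1 ht.2
              (Filter.Eventually.of_forall fun τ => by positivity) (hi1.const_mul C)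
        _ = _ := intervalIntegral.integral_const_mul _ _
    calc ‖φ t - φ t₀‖ ^ 2 ≤ (C * ∫ τ in t₀..(t₀ + δ), ‖W τ (φ τ)‖) ^ 2 := by gcongr
      _ = C ^ 2 * (∫ τ in t₀..(t₀ + δ), ‖W τ (φ τ)‖) ^ 2 := mul_pow _ _ _
      _ ≤ C ^ 2 * (δ * J) := by
          gcongr
          exact sq_intervalIntegral_le hδ hi1 (hi 2)
  have hpoint (t : ℝ) (ht : t ∈ Icc t₀ (t₀ + δ)) :
      ‖W t (φ t₀)‖ ^ 2 ≤ 2 * ‖W t (φ t)‖ ^ 2 + 2 * (C ^ 4 * (δ * J)) := by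
    have h1 : ‖W t (φ t₀)‖ ≤ ‖W t (φ t)‖ + ‖W t (φ t - φ t₀)‖ := by
      rw [map_sub]
      simpa using norm_sub_le (W t (φ t)) (W t (φ t) - W t (φ t₀))
    have h2 : ‖W t (φ t - φ t₀)‖ ^ 2 ≤ C ^ 4 * (δ * J) := by
      calc ‖W t (φ t - φ t₀)‖ ^ 2 ≤ (C * ‖φ t - φ t₀‖) ^ 2 := by
            gcongr
            exact (W t).le_of_opNorm_le (hC t) _
        _ = C ^ 2 * ‖φ t - φ t₀‖ ^ 2 := mul_pow _ _ _
        _ ≤ C ^ 2 * (C ^ 2 * (δ * J)) := by gcongr; exact hdist t ht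
        _ = _ := by ring
    nlinarith [norm_nonneg (W t (φ t₀)), sq_nonneg (‖W t (φ t)‖ - ‖W t (φ t - φ t₀)‖)]
  have hint : ∫ t in t₀..(t₀ + δ), ‖W t (φ t₀)‖ ^ 2 ≤ 2 * J + 2 * (C ^ 4 * (δ * J)) * δ := by
    calc ∫ t in t₀..(t₀ + δ), ‖W t (φ t₀)‖ ^ 2
        ≤ ∫ t in t₀..(t₀ + δ), (2 * ‖W t (φ t)‖ ^ 2 + 2 * (C ^ 4 * (δ * J))) :=
          intervalIntegral.integral_mono_on (by linarith)
            (intervalIntegrable_norm_apply_pow hW hC continuous_const 2 _ _)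
            (((hi 2).const_mul 2).add intervalIntegrable_const) hpoint
      _ = _ := by
          rw [intervalIntegral.integral_add ((hi 2).const_mul 2) intervalIntegrable_const,
            intervalIntegral.integral_const_mul, intervalIntegral.integral_const, smul_eq_mul]
          ring
  have hpos : 0 < 1 + C ^ 4 * δ ^ 2 := by positivity
  -- Excitation of the frozen vector `φ t₀` gives `c ‖φ t₀‖² ≤ 2 J (1 + C⁴ δ²)`.
  have h5 : c / (1 + C ^ 4 * δ ^ 2) * ‖φ t₀‖ ^ 2 ≤ 2 * J := by
    rw [div_mul_eq_mul_div, div_le_iff₀ hpos]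
    nlinarith
  linarith

/-- Persistent excitation gives uniform exponential decay of the solutions of `φ' = -W†Wφ`. -/
theorem exists_exp_decay_of_excitation {W : ℝ → E →L[ℝ] F} {C δ c : ℝ}
    (hW : AEStronglyMeasurable W volume) (hC : ∀ t, ‖W t‖ ≤ C) (hδ : 0 < δ) (hc : 0 < c)
    (hpe : ∀ t₀ ≥ (0 : ℝ), ∀ v, c * ‖v‖ ^ 2 ≤ ∫ t in t₀..(t₀ + δ), ‖W t v‖ ^ 2) :
    ∃ M > (0 : ℝ), ∃ β > (0 : ℝ), ∀ φ G : ℝ → E, LocallyLipschitz φ →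
      (∀ᵐ t, HasDerivAt φ (-G t) t) → (∀ t, ⟪φ t, G t⟫ = ‖W t (φ t)‖ ^ 2) →
      (∀ t, ‖G t‖ ≤ C * ‖W t (φ t)‖) → ∀ s t : ℝ, 0 ≤ s → s ≤ t →
      ‖φ t‖ ≤ M * Real.exp (-β * (t - s)) * ‖φ s‖ := by
  -- The maximum with `1 / 2` keeps the ratio positive, so that its logarithm gives a rate.
  set r : ℝ := max (1 - c / (1 + C ^ 4 * δ ^ 2)) (1 / 2) with hr
  have hr0 : 0 < r := lt_of_lt_of_le (by norm_num) (le_max_right _ _)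
  have hr1 : r < 1 := max_lt (by
    have : 0 < c / (1 + C ^ 4 * δ ^ 2) := by positivity
    linarith) (by norm_num)
  have hlog : 0 < -Real.log r / δ := div_pos (neg_pos.2 (Real.log_neg hr0 hr1)) hδ
  -- The decay is proved for `‖φ‖²`; taking square roots halves the rate.
  refine ⟨√(1 / r), by positivity, -Real.log r / δ / 2, by positivity,
    fun φ G hφ hd hG hGC s t hs hst => ?_⟩
  have hanti := norm_sq_antitone_of_dissipative hφ hd fun t => by rw [hG]; positivity
  have key := le_exp_of_step_le (f := fun t => ‖φ t‖ ^ 2) (s := s) (D := 1) hδ hr0 hr1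
    (fun u _ t ht => by rw [one_mul]; exact hanti ht.1) zero_le_one
    (fun t ht => (norm_sq_add_le_of_excitation hW hC hδ hφ hd hG hGC
      (hpe t (hs.trans ht) _)).trans (by gcongr; exact le_max_left _ _)) (by positivity) hst
  refine (pow_le_pow_iff_left₀ (norm_nonneg _) (by positivity) two_ne_zero).1 (key.trans_eq ?_)
  rw [mul_pow, mul_pow, Real.sq_sqrt (by positivity), ← Real.exp_nat_mul]
  congr 3
  push_cast
  ring

end Excitation

/-! ### Response of a stable linear system to a decaying input -/

section Forcing

open NormedSpace

variable {E : Type*} [NormedAddCommGroup E] [NormedSpace ℝ E] [CompleteSpace E]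

theorem contDiff_exp_smul_const (H : E →L[ℝ] E) : ContDiff ℝ 1 fun t : ℝ => exp (t • H) := by
  have hc : Continuous fun t : ℝ => exp (t • H) := continuous_iff_continuousAt.2 fun t =>
    (hasDerivAt_exp_smul_const H t).continuousAt
  refine contDiff_one_iff_deriv.2 ⟨fun t => (hasDerivAt_exp_smul_const H t).differentiableAt, ?_⟩
  have hderiv : deriv (fun t : ℝ => exp (t • H)) = fun t => exp (t • H) * H :=
    funext fun t => (hasDerivAt_exp_smul_const H t).deriv
  rw [hderiv]
  exact hc.mul continuous_const

/-- The variation of constants formula. -/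
theorem variation_of_constants {H : E →L[ℝ] E} {e h : ℝ → E} (he : LocallyLipschitz e)
    (hd : ∀ᵐ t, HasDerivAt e (H (e t) + h t) t) (s t : ℝ) :
    e t = exp ((t - s) • H) (e s) + ∫ τ in s..t, exp ((t - τ) • H) (h τ) := by
  have hy : LocallyLipschitz fun τ => exp ((t - τ) • H) (e τ) := by
    have h1 : ContDiff ℝ 1 fun τ : ℝ => exp ((t - τ) • H) :=
      (contDiff_exp_smul_const H).comp (contDiff_const.sub contDiff_id)
    exact (isBoundedBilinearMap_apply.contDiff (n := 1)).locallyLipschitz.comp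
      (h1.locallyLipschitz.prodMk he)
  -- The two terms containing `H` cancel in the product rule, leaving only the forcing.
  have hyd : ∀ᵐ τ, HasDerivAt (fun τ => exp ((t - τ) • H) (e τ))
      (exp ((t - τ) • H) (h τ)) τ := by
    filter_upwards [hd] with τ hτ
    have h1 : HasDerivAt (fun τ : ℝ => exp ((t - τ) • H)) (-(exp ((t - τ) • H) * H)) τ := by
      have := (hasDerivAt_exp_smul_const H (t - τ)).scomp τ ((hasDerivAt_id τ).const_sub t)
      simp only [neg_smul, one_smul] at this
      exact this
    convert h1.clm_apply hτ using 1
    simp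
  have := hy.sub_eq_integral hyd s t
  simp only [sub_self, zero_smul, exp_zero, one_apply_eq_self] at this
  rw [← this]
  abel

/-- With a common rate `γ`, the product of the bounds on kernel and forcing does not depend on `τ`,
so the integral contributes only a factor `t - s`. This needs no distinction between equal and
different rates. -/
theorem norm_le_of_forcing {H : E →L[ℝ] E} {C α γ L : ℝ} (hαγ : γ ≤ α)
    (hH : ∀ t ≥ (0 : ℝ), ‖exp (t • H)‖ ≤ C * Real.exp (-α * t)) {e h : ℝ → E}
    (he : LocallyLipschitz e) (hd : ∀ᵐ t, HasDerivAt e (H (e t) + h t) t) {s t : ℝ} (hst : s ≤ t)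
    (hh : ∀ τ ∈ Icc s t, ‖h τ‖ ≤ L * Real.exp (-γ * (τ - s))) :
    ‖e t‖ ≤ C * (‖e s‖ + L * (t - s)) * Real.exp (-γ * (t - s)) := by
  have hC : 0 ≤ C := by simpa using (norm_nonneg _).trans (hH 0 le_rfl)
  have hH' (u : ℝ) (hu : 0 ≤ u) : ‖exp (u • H)‖ ≤ C * Real.exp (-γ * u) :=
    (hH u hu).trans (by gcongr)
  have h1 : ‖∫ τ in s..t, exp ((t - τ) • H) (h τ)‖ ≤
      C * L * Real.exp (-γ * (t - s)) * |t - s| := by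
    refine intervalIntegral.norm_integral_le_of_norm_le_const fun τ hτ => ?_
    rw [uIoc_of_le hst] at hτ
    calc ‖exp ((t - τ) • H) (h τ)‖
        ≤ (C * Real.exp (-γ * (t - τ))) * (L * Real.exp (-γ * (τ - s))) :=
          ContinuousLinearMap.le_of_opNorm_le_of_le _ (hH' _ (by linarith [hτ.2]))
            (hh τ (Ioc_subset_Icc_self hτ))
      _ = C * L * (Real.exp (-γ * (t - τ)) * Real.exp (-γ * (τ - s))) := by ring
      _ = _ := by
          rw [← Real.exp_add]
          ring_nf
  rw [abs_of_nonneg (by linarith)] at h1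
  have h2 : ‖exp ((t - s) • H) (e s)‖ ≤ C * Real.exp (-γ * (t - s)) * ‖e s‖ :=
    ContinuousLinearMap.le_of_opNorm_le _ (hH' _ (by linarith)) _
  rw [variation_of_constants he hd s t]
  refine (norm_add_le _ _).trans ((add_le_add h2 h1).trans_eq ?_)
  ring

end Forcing

/-! ### Matrices as operators on Euclidean spaces, and block coordinates -/

section Euclidean

open scoped RealInnerProductSpace

variable {l m n : Type*} [Fintype l] [Fintype m] [Fintype n]

theorem EuclideanSpace.inner_eq_dotProduct (v w : EuclideanSpace ℝ n) :
    ⟪v, w⟫ = v.ofLp ⬝ᵥ w.ofLp := by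
  rw [EuclideanSpace.inner_eq_star_dotProduct, dotProduct_comm]
  simp

/-- Projection of the Euclidean space over a disjoint union to the first summand. -/
noncomputable def euclideanFst : EuclideanSpace ℝ (m ⊕ n) →L[ℝ] EuclideanSpace ℝ m :=
  LinearMap.toContinuousLinearMap
    { toFun := fun x => WithLp.toLp 2 fun i => x (Sum.inl i)
      map_add' := fun _ _ => rfl
      map_smul' := fun _ _ => rfl }

/-- Projection of the Euclidean space over a disjoint union to the second summand. -/
noncomputable def euclideanSnd : EuclideanSpace ℝ (m ⊕ n) →L[ℝ] EuclideanSpace ℝ n :=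
  LinearMap.toContinuousLinearMap
    { toFun := fun x => WithLp.toLp 2 fun i => x (Sum.inr i)
      map_add' := fun _ _ => rfl
      map_smul' := fun _ _ => rfl }

theorem norm_sq_euclidean_sum (x : EuclideanSpace ℝ (m ⊕ n)) :
    ‖x‖ ^ 2 = ‖euclideanFst x‖ ^ 2 + ‖euclideanSnd x‖ ^ 2 := by
  simp only [EuclideanSpace.norm_sq_eq, Fintype.sum_sum_type]
  rfl

theorem norm_euclideanFst_le (x : EuclideanSpace ℝ (m ⊕ n)) : ‖euclideanFst x‖ ≤ ‖x‖ := by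
  refine (pow_le_pow_iff_left₀ (norm_nonneg _) (norm_nonneg _) two_ne_zero).1 ?_
  rw [norm_sq_euclidean_sum x]
  exact le_add_of_nonneg_right (sq_nonneg _)

theorem norm_euclideanSnd_le (x : EuclideanSpace ℝ (m ⊕ n)) : ‖euclideanSnd x‖ ≤ ‖x‖ := by
  refine (pow_le_pow_iff_left₀ (norm_nonneg _) (norm_nonneg _) two_ne_zero).1 ?_
  rw [norm_sq_euclidean_sum x]
  exact le_add_of_nonneg_left (sq_nonneg _)

theorem norm_le_add_euclidean (x : EuclideanSpace ℝ (m ⊕ n)) :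
    ‖x‖ ≤ ‖euclideanFst x‖ + ‖euclideanSnd x‖ := by
  refine (pow_le_pow_iff_left₀ (norm_nonneg _) (by positivity) two_ne_zero).1 ?_
  rw [norm_sq_euclidean_sum x]
  nlinarith [norm_nonneg (euclideanFst x), norm_nonneg (euclideanSnd x)]

variable [DecidableEq n]

/-- The continuous linear map between Euclidean spaces given by a rectangular matrix. -/
noncomputable def Matrix.euclideanMap :
    Matrix m n ℝ →ₗ[ℝ] (EuclideanSpace ℝ n →L[ℝ] EuclideanSpace ℝ m) :=
  ((Matrix.toEuclideanLin (𝕜 := ℝ) (m := m) (n := n)).trans LinearMap.toContinuousLinearMap :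
    Matrix m n ℝ ≃ₗ[ℝ] (EuclideanSpace ℝ n →L[ℝ] EuclideanSpace ℝ m))

theorem Matrix.norm_euclideanMap (A : Matrix m n ℝ) : ‖A.euclideanMap‖ = ‖A‖ := rfl

theorem Matrix.ofLp_euclideanMap (A : Matrix m n ℝ) (v : EuclideanSpace ℝ n) :
    (A.euclideanMap v).ofLp = A *ᵥ v.ofLp := rfl

theorem Matrix.euclideanMap_mul [DecidableEq m] (A : Matrix l m ℝ) (B : Matrix m n ℝ)
    (v : EuclideanSpace ℝ n) : (A * B).euclideanMap v = A.euclideanMap (B.euclideanMap v) := by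
  apply WithLp.ofLp_injective
  simp only [Matrix.ofLp_euclideanMap, Matrix.mulVec_mulVec]

theorem Matrix.exp_euclideanMap (A : Matrix n n ℝ) :
    NormedSpace.exp A.euclideanMap = (NormedSpace.exp A).euclideanMap := by
  have hc : Continuous (Matrix.toEuclideanCLM (n := n) (𝕜 := ℝ)) :=
    LinearMap.continuous_of_finiteDimensional (Matrix.euclideanMap (m := n) (n := n))
  let := NormedAlgebra.restrictScalars ℚ ℝ (Matrix n n ℝ)
  let := NormedAlgebra.restrictScalars ℚ ℝ (EuclideanSpace ℝ n →L[ℝ] EuclideanSpace ℝ n)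
  exact (NormedSpace.map_exp (Matrix.toEuclideanCLM (n := n) (𝕜 := ℝ)) hc A).symm

/-- With `A = W t`, this and the next bound supply the two properties of `G = WᵀWφ` required by
`exists_exp_decay_of_excitation`. -/
theorem Matrix.inner_gram_euclideanMap [DecidableEq m] (A : Matrix m n ℝ)
    (v : EuclideanSpace ℝ n) : ⟪v, (Aᵀ * A).euclideanMap v⟫ = ‖A.euclideanMap v‖ ^ 2 := by
  rw [← real_inner_self_eq_norm_sq, EuclideanSpace.inner_eq_dotProduct,
    EuclideanSpace.inner_eq_dotProduct]
  simp only [Matrix.ofLp_euclideanMap]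
  rw [← Matrix.mulVec_mulVec, Matrix.dotProduct_mulVec, Matrix.vecMul_transpose]

theorem Matrix.norm_gram_euclideanMap_le [DecidableEq m] (A : Matrix m n ℝ)
    (v : EuclideanSpace ℝ n) : ‖(Aᵀ * A).euclideanMap v‖ ≤ ‖A‖ * ‖A.euclideanMap v‖ := by
  have h : ‖Aᵀ‖ = ‖A‖ := by
    rw [← Matrix.conjTranspose_eq_transpose_of_trivial, Matrix.l2_opNorm_conjTranspose]
  rw [Matrix.euclideanMap_mul, ← h]
  exact (Aᵀ.euclideanMap).le_opNorm _

theorem euclideanFst_fromBlocks [DecidableEq m] (P : Matrix m m ℝ) (Q : Matrix m n ℝ)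
    (R : Matrix n m ℝ) (S : Matrix n n ℝ) (x : EuclideanSpace ℝ (m ⊕ n)) :
    euclideanFst ((Matrix.fromBlocks P Q R S).euclideanMap x) =
      P.euclideanMap (euclideanFst x) + Q.euclideanMap (euclideanSnd x) := by
  apply WithLp.ofLp_injective
  funext i
  change (Matrix.fromBlocks P Q R S *ᵥ x.ofLp) (Sum.inl i) = _
  rw [Matrix.fromBlocks_mulVec]
  rfl

theorem euclideanSnd_fromBlocks [DecidableEq m] (P : Matrix m m ℝ) (Q : Matrix m n ℝ)
    (R : Matrix n m ℝ) (S : Matrix n n ℝ) (x : EuclideanSpace ℝ (m ⊕ n)) :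
    euclideanSnd ((Matrix.fromBlocks P Q R S).euclideanMap x) =
      R.euclideanMap (euclideanFst x) + S.euclideanMap (euclideanSnd x) := by
  apply WithLp.ofLp_injective
  funext i
  change (Matrix.fromBlocks P Q R S *ᵥ x.ofLp) (Sum.inr i) = _
  rw [Matrix.fromBlocks_mulVec]
  rfl

end Euclidean

/-! ### Excitation and transition matrices tested on vectors -/

theorem Matrix.continuous_euclideanMap {m n : Type*} [Fintype m] [Fintype n] [DecidableEq n] :
    Continuous (Matrix.euclideanMap (m := m) (n := n)) :=
  LinearMap.continuous_of_finiteDimensional _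

theorem PersistentlyExciting.exists_le_integral {q p : ℕ} {W : ℝ → Matrix (Fin q) (Fin p) ℝ}
    {C : ℝ} (hpe : PersistentlyExciting W) (hW : AEStronglyMeasurable W volume)
    (hC : ∀ t, ‖W t‖ ≤ C) :
    ∃ δ > (0 : ℝ), ∃ c > (0 : ℝ), ∀ t₀ ≥ (0 : ℝ), ∀ v : EuclideanSpace ℝ (Fin p),
      c * ‖v‖ ^ 2 ≤ ∫ t in t₀..(t₀ + δ), ‖(W t).euclideanMap v‖ ^ 2 := by
  obtain ⟨δ, hδ, _, _, c, hc, h⟩ := hpe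
  refine ⟨δ, hδ, c, hc, fun t₀ ht₀ v => ?_⟩
  have hC0 : 0 ≤ C := (norm_nonneg _).trans (hC 0)
  have hi : IntervalIntegrable (fun t => (W t)ᵀ * W t) volume t₀ (t₀ + δ) := by
    have hc : Continuous fun w : Matrix (Fin q) (Fin p) ℝ => wᵀ * w := by fun_prop
    rw [intervalIntegrable_iff]
    refine Measure.integrableOn_of_bounded (M := C * C) (by simp)
      (hc.comp_aestronglyMeasurable hW) (Filter.Eventually.of_forall fun t => ?_)
    rw [← Matrix.conjTranspose_eq_transpose_of_trivial, Matrix.l2_opNorm_conjTranspose_mul_self]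
    exact mul_le_mul (hC t) (hC t) (norm_nonneg _) hC0
  -- The quadratic form at a fixed `v` is continuous and linear in the matrix, so it commutes with
  -- the integral.
  let ℓ : Matrix (Fin p) (Fin p) ℝ →L[ℝ] ℝ :=
    (innerSL ℝ v).comp ((ContinuousLinearMap.apply ℝ (EuclideanSpace ℝ (Fin p)) v).comp
      ⟨Matrix.euclideanMap, Matrix.continuous_euclideanMap⟩)
  have hℓ (A : Matrix (Fin p) (Fin p) ℝ) : ℓ A = inner ℝ v (A.euclideanMap v) := rfl
  have hsum : ∫ t in t₀..(t₀ + δ), ‖(W t).euclideanMap v‖ ^ 2 =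
      ℓ (∫ t in t₀..(t₀ + δ), (W t)ᵀ * W t) := by
    rw [← ℓ.intervalIntegral_comp_comm hi]
    simp only [hℓ, Matrix.inner_gram_euclideanMap]
  have hpos := (h t₀ ht₀).2.posSemidef.dotProduct_mulVec_nonneg v.ofLp
  have h1 : 0 ≤ ℓ ((∫ t in t₀..(t₀ + δ), (W t)ᵀ * W t) - c • 1) := by
    rw [hℓ, EuclideanSpace.inner_eq_dotProduct]
    exact hpos
  have h2 : ℓ 1 = ‖v‖ ^ 2 := by
    rw [hℓ, EuclideanSpace.inner_eq_dotProduct, Matrix.ofLp_euclideanMap, Matrix.one_mulVec,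
      ← EuclideanSpace.inner_eq_dotProduct, real_inner_self_eq_norm_sq]
  rw [map_sub, map_smul, h2, smul_eq_mul] at h1
  rw [hsum]
  linarith

theorem exists_norm_errorDynamics_le {d q p : ℕ}
    (A : Matrix (Fin d) (Fin d) ℝ) (B : Matrix (Fin d) (Fin q) ℝ) (K : Matrix (Fin q) (Fin d) ℝ)
    {W : ℝ → Matrix (Fin q) (Fin p) ℝ} {C : ℝ} (hC : ∀ t, ‖W t‖ ≤ C) :
    ∃ D : ℝ, ∀ t, ‖errorDynamics A B K W t‖ ≤ D := by
  have hc : Continuous fun w : Matrix (Fin q) (Fin p) ℝ =>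
      Matrix.fromBlocks (A + B * K) (B * w) 0 (-(wᵀ * w)) := by
    fun_prop
  obtain ⟨D, hD⟩ := (isCompact_closedBall (0 : Matrix (Fin q) (Fin p) ℝ) C
    ).exists_bound_of_continuousOn hc.continuousOn
  exact ⟨D, fun t => hD _ (by simpa using hC t)⟩

theorem IsStateTransitionMatrix.locallyLipschitz {ι : Type*} [Fintype ι] [DecidableEq ι]
    {F : ℝ → Matrix ι ι ℝ} {Φ : ℝ → ℝ → Matrix ι ι ℝ} (hΦ : IsStateTransitionMatrix F Φ) {D : ℝ}
    (hF : ∀ t, ‖F t‖ ≤ D) (s : ℝ) : LocallyLipschitz fun t => Φ t s := by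
  refine locallyLipschitz_of_absolutelyContinuous (hΦ.absolutelyContinuous s) (hΦ.hasDerivAt s)
    fun a b => ?_
  obtain ⟨N, hN⟩ := isCompact_uIcc.exists_bound_of_continuousOn
    (hΦ.absolutelyContinuous s a b).continuousOn
  refine ⟨D * N, Filter.Eventually.of_forall fun t ht => (norm_mul_le _ _).trans ?_⟩
  exact mul_le_mul (hF t) (hN t ht) (norm_nonneg _) ((norm_nonneg _).trans (hF t))

/-- A state transition matrix applied to a vector solves the equation. -/
theorem IsStateTransitionMatrix.hasDerivAt_euclideanMap {ι : Type*} [Fintype ι] [DecidableEq ι]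
    {F : ℝ → Matrix ι ι ℝ} {Φ : ℝ → ℝ → Matrix ι ι ℝ} (hΦ : IsStateTransitionMatrix F Φ)
    (s : ℝ) (v : EuclideanSpace ℝ ι) :
    ∀ᵐ t, HasDerivAt (fun t => (Φ t s).euclideanMap v)
      ((F t).euclideanMap ((Φ t s).euclideanMap v)) t := by
  let ℓ : Matrix ι ι ℝ →L[ℝ] EuclideanSpace ℝ ι :=
    (ContinuousLinearMap.apply ℝ (EuclideanSpace ℝ ι) v).comp
      ⟨Matrix.euclideanMap, Matrix.continuous_euclideanMap⟩
  filter_upwards [hΦ.hasDerivAt s] with t ht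
  rw [← Matrix.euclideanMap_mul]
  exact ℓ.hasFDerivAt.comp_hasDerivAt t ht

theorem IsStateTransitionMatrix.locallyLipschitz_euclideanMap {ι : Type*} [Fintype ι]
    [DecidableEq ι] {F : ℝ → Matrix ι ι ℝ} {Φ : ℝ → ℝ → Matrix ι ι ℝ}
    (hΦ : IsStateTransitionMatrix F Φ) {D : ℝ} (hF : ∀ t, ‖F t‖ ≤ D) (s : ℝ)
    (v : EuclideanSpace ℝ ι) : LocallyLipschitz fun t => (Φ t s).euclideanMap v := by
  let ℓ : Matrix ι ι ℝ →L[ℝ] EuclideanSpace ℝ ι :=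
    (ContinuousLinearMap.apply ℝ (EuclideanSpace ℝ ι) v).comp
      ⟨Matrix.euclideanMap, Matrix.continuous_euclideanMap⟩
  exact ℓ.lipschitz.locallyLipschitz.comp (hΦ.locallyLipschitz hF s)

/-! ### Assembly of the cascade -/

theorem lemma1 {d q p : ℕ}
    (A : Matrix (Fin d) (Fin d) ℝ) (B : Matrix (Fin d) (Fin q) ℝ) (K : Matrix (Fin q) (Fin d) ℝ)
    (hAK : IsHurwitz (A + B * K))
    (W : ℝ → Matrix (Fin q) (Fin p) ℝ) (hW : AEStronglyMeasurable W volume)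
    (hbdd : ∃ C > (0 : ℝ), ∀ t : ℝ, ‖W t‖ < C)
    (hpe : PersistentlyExciting W)
    (Φ : ℝ → ℝ → Matrix (Fin d ⊕ Fin p) (Fin d ⊕ Fin p) ℝ)
    (hΦ : IsStateTransitionMatrix (errorDynamics A B K W) Φ) :
    ∃ M > (0 : ℝ), ∃ ζ > (0 : ℝ), ∀ t₁ t₂ : ℝ, 0 ≤ t₂ → t₂ ≤ t₁ →
      ‖Φ t₁ t₂‖ ≤ M * Real.exp (-ζ * (t₁ - t₂)) := by
  obtain ⟨C, hC0, hC'⟩ := hbdd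
  have hC (t : ℝ) : ‖W t‖ ≤ C := (hC' t).le
  obtain ⟨D, hD⟩ := exists_norm_errorDynamics_le A B K hC
  obtain ⟨δ, hδ, c, hc, hexc⟩ := hpe.exists_le_integral hW hC
  obtain ⟨M₁, hM₁, β, hβ, hdecay⟩ := exists_exp_decay_of_excitation
    (W := fun t => (W t).euclideanMap)
    (Matrix.continuous_euclideanMap.comp_aestronglyMeasurable hW) hC hδ hc hexc
  obtain ⟨M₂, hM₂, α, hα, hexp⟩ := hAK.exists_norm_exp_le
  set γ := min α β with hγ
  have hγ0 : 0 < γ := lt_min hα hβ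
  set L := ‖B‖ * C * M₁ with hL
  have hL0 : 0 ≤ L := by positivity
  -- The rate `γ / 2` leaves a spare factor `exp (-γ (t - s) / 2)`, and `2 / γ` bounds `t - s` times
  -- that factor.
  refine ⟨M₂ * (1 + L * (2 / γ)) + M₁, by positivity, γ / 2, by positivity,
    fun t s hs hst => ?_⟩
  rw [← Matrix.norm_euclideanMap]
  refine ContinuousLinearMap.opNorm_le_bound _ (by positivity) fun v => ?_
  set x : ℝ → EuclideanSpace ℝ (Fin d ⊕ Fin p) := fun t => (Φ t s).euclideanMap v with hx
  have hxs : x s = v := by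
    apply WithLp.ofLp_injective
    simp only [hx, hΦ.self, Matrix.ofLp_euclideanMap, Matrix.one_mulVec]
  have hxL : LocallyLipschitz x := hΦ.locallyLipschitz_euclideanMap hD s v
  have hxd : ∀ᵐ t, HasDerivAt x ((errorDynamics A B K W t).euclideanMap (x t)) t :=
    hΦ.hasDerivAt_euclideanMap s v
  have hφL : LocallyLipschitz fun t => euclideanSnd (x t) :=
    (euclideanSnd (m := Fin d) (n := Fin p)).lipschitz.locallyLipschitz.comp hxL
  have hφd : ∀ᵐ t, HasDerivAt (fun t => euclideanSnd (x t))
      (-((W t)ᵀ * W t).euclideanMap (euclideanSnd (x t))) t := by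
    filter_upwards [hxd] with t ht
    have := euclideanSnd.hasFDerivAt.comp_hasDerivAt t ht
    rw [errorDynamics, euclideanSnd_fromBlocks, map_zero, map_neg] at this
    simp only [zero_apply, neg_apply, zero_add] at this
    exact this
  have heL : LocallyLipschitz fun t => euclideanFst (x t) :=
    (euclideanFst (m := Fin d) (n := Fin p)).lipschitz.locallyLipschitz.comp hxL
  have hed : ∀ᵐ t, HasDerivAt (fun t => euclideanFst (x t))
      ((A + B * K).euclideanMap (euclideanFst (x t)) +
        (B * W t).euclideanMap (euclideanSnd (x t))) t := by
    filter_upwards [hxd] with t ht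
    have := euclideanFst.hasFDerivAt.comp_hasDerivAt t ht
    rwa [errorDynamics, euclideanFst_fromBlocks] at this
  have hφ (τ : ℝ) (hτ : s ≤ τ) :
      ‖euclideanSnd (x τ)‖ ≤ M₁ * Real.exp (-γ * (τ - s)) * ‖v‖ := by
    have h1 := hdecay _ _ hφL hφd (fun τ => Matrix.inner_gram_euclideanMap _ _)
      (fun τ => (Matrix.norm_gram_euclideanMap_le _ _).trans (by gcongr; exact hC τ)) s τ hs hτ
    refine h1.trans ?_
    gcongr
    · exact min_le_right _ _
    · exact (norm_euclideanSnd_le _).trans_eq (by rw [hxs])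
  have he := norm_le_of_forcing (C := M₂) (α := α) (γ := γ) (L := L * ‖v‖) (min_le_left _ _)
    (fun u hu => by
      rw [← map_smul, Matrix.exp_euclideanMap, Matrix.norm_euclideanMap]
      exact hexp u hu) heL hed hst (fun τ hτ => by
      rw [Matrix.euclideanMap_mul]
      calc ‖B.euclideanMap ((W τ).euclideanMap (euclideanSnd (x τ)))‖
          ≤ ‖B‖ * (C * (M₁ * Real.exp (-γ * (τ - s)) * ‖v‖)) :=
            ContinuousLinearMap.le_of_opNorm_le_of_le _ (Matrix.norm_euclideanMap B).le
              (ContinuousLinearMap.le_of_opNorm_le_of_le _ (hC τ) (hφ τ hτ.1))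
        _ = _ := by rw [hL]; ring)
  have hes : ‖euclideanFst (x s)‖ ≤ ‖v‖ := (norm_euclideanFst_le _).trans_eq (by rw [hxs])
  set E := Real.exp (-(γ / 2) * (t - s)) with hE
  have hE0 : 0 < E := Real.exp_pos _
  have hEE : Real.exp (-γ * (t - s)) = E * E := by
    rw [hE, ← Real.exp_add]
    ring_nf
  have hE1 : E ≤ 1 := Real.exp_le_one_iff.2 (by nlinarith)
  -- This is `x + 1 ≤ exp x` at `x = γ (t - s) / 2`, multiplied by `E = exp (-x)`.
  have hlin : (t - s) * E ≤ 2 / γ := by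
    have h1 := Real.add_one_le_exp (γ / 2 * (t - s))
    have h2 : Real.exp (γ / 2 * (t - s)) * E = 1 := by
      rw [hE, ← Real.exp_add]
      simp
    rw [le_div_iff₀ hγ0]
    nlinarith
  have he' : ‖euclideanFst (x t)‖ ≤ M₂ * (1 + L * (2 / γ)) * E * ‖v‖ := by
    calc ‖euclideanFst (x t)‖ ≤ M₂ * (‖v‖ + L * ‖v‖ * (t - s)) * (E * E) := by
          rw [← hEE]
          exact he.trans (by gcongr)
      _ = M₂ * (E + L * ((t - s) * E)) * E * ‖v‖ := by ring
      _ ≤ _ := by gcongr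
  have hφ' : ‖euclideanSnd (x t)‖ ≤ M₁ * E * ‖v‖ := by
    refine (hφ t hst).trans ?_
    rw [hEE]
    gcongr
    nlinarith
  calc ‖x t‖ ≤ ‖euclideanFst (x t)‖ + ‖euclideanSnd (x t)‖ := norm_le_add_euclidean _
    _ ≤ M₂ * (1 + L * (2 / γ)) * E * ‖v‖ + M₁ * E * ‖v‖ := add_le_add he' hφ'
    _ = _ := by ring
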